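/- **Terms.** Consider the terms of the modal $\lambda$-calculus $\lambda^!$, $$M,N ::= x \mid \lambda x.M \mid MN \mid\; !M \mid \mathsf{let}\,!x=N\,\mathsf{in}\,M ,$$ identified up to renaming of bound variables ($x$ is bound in $M$ both in $\lambda x.M$ and in $\mathsf{let}\,!x=N\,\mathsf{in}\,M$). Strong reduction $\to$ is generated by $(\lambda x.M)N\to M[N/x]$ and $\mathsf{let}\,!x=\,!N\,\mathsf{in}\,M\to M[N/x]$ applied in arbitrary contexts (in particular under $\lambda$), and $\to^*$ is its reflexive transitive closure. Write $!^p$ for $p$ successive $!$'s. **Types.** Types are $A,B ::= t \mid \mathbf 1\mid A\multimap B \mid\; !A \mid \forall t.A$. The typed functional core $\lambda^!_{EA}$ consists of the terms typable by judgements $\Gamma\vdash^\delta M:A$, with $\delta\in\mathbb N$ and $\Gamma=x_1:(\delta_1,A_1),\dots,x_n:(\delta_n,A_n)$, derived by the following rules: - $\Gamma\vdash^\delta x:A$ if $x:(\delta,A)\in\Gamma$; - if $\Gamma,x:(\delta,A)\vdash^\delta M:B$ and $x$ occurs free at most once in $M$, then $\Gamma\vdash^\delta\lambda x.M:A\multimap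 B$; - if $\Gamma\vdash^\delta M:A\multimap B$ and $\Gamma\vdash^\delta N:A$, then $\Gamma\vdash^\delta MN:B$; - if $\Gamma\vdash^{\delta+1}M:A$, then $\Gamma\vdash^\delta\;!M:\;!A$; - if $\Gamma\vdash^\delta M:\;!A$ and $\Gamma,x:(\delta+1,A)\vdash^\delta N:B$, then $\Gamma\vdash^\delta\mathsf{let}\,!x=M\,\mathsf{in}\,N:B$; - if $\Gamma\vdash^\delta M:A$ and $t$ is not free in $\Gamma$, then $\Gamma\vdash^\delta M:\forall t.A$; - if $\Gamma\vdash^\delta M:\forall t.A$, then $\Gamma\vdash^\delta M:A[B/t]$ for every type $B$. **Representation.** Let $\mathsf N=\forall t.\,!(t\multimap t)\multimap\,!(t\multimap t)$, and let $\overline n=\lambda f.\mathsf{let}\,!f=f\,\mathsf{in}\,!(\lambda x.f(\cdots(fx)\cdots))$, with $n$ applications of $f$, be the Church numeral of $n$. A term $M$ with $\emptyset\vdash^\delta M:\;!^p\mathsf N$ represents $n\in\mathbb N$, written $M\Vdash n$, if $M\to^*\;!^p\,\overline n$. A term $F$ with $\emptyset\vdash^\delta F:\mathsf N\multimap\cdots\multimap\mathsf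 N\multimap\,!^p\mathsf N$ ($k$ arguments, $p\ge 0$) represents $f:\mathbb N^k\to\mathbb N$ if for all terms $M_1,\dots,M_k$ and all $n_1,\dots,n_k\in\mathbb N$ such that $\emptyset\vdash^\delta M_i:\mathsf N$ and $M_i\Vdash n_i$ for every $i$, the term $FM_1\cdots M_k$ is of type $!^p\mathsf N$ in the empty context at depth $\delta$ and $FM_1\cdots M_k\Vdash f(n_1,\dots,n_k)$. **Elementary functions.** The elementary functions are the smallest class of functions $\mathbb N^k\to\mathbb N$ ($k\ge0$) that contains the zero functions, the successor, the projections and truncated subtraction, and is closed under composition and under bounded sums $\sum_{1\le i\le n}f(i,x_1,\dots,x_k)$ and bounded products $\prod_{1\le i\le n}f(i,x_1,\dots,x_k)$, as functions of $(n,x_1,\dots,x_k)$. **Theorem (completeness).** Every elementary function is representable in $\lambda^!_{EA}$: for every elementary $f:\mathbb N^k\to\mathbb N$ there are $p\ge 0$ and a closed term $F$ such that, for every depth $\delta$, $\emptyset\vdash^\delta F:\mathsf N\multimap\cdots\multimap\mathsf N\multimap\,!^p\mathsf N$ and $F$ represents $f$. -/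

import Mathlib

namespace EA

/-- Terms of the modal functional calculus, up to renaming of bound variables (de Bruijn indices):
`x`, `λx.M`, `M N`, `!M` and `let !x = N in M`.
In `letb N M` the term `M` (but not `N`) is under the binder. -/
inductive Tm : Type
  | var : ℕ → Tm
  | lam : Tm → Tm
  | app : Tm → Tm → Tm
  | bang : Tm → Tm
  | letb : Tm → Tm → Tm

namespace Tm

/-- Extension of a renaming below one binder. -/
def upr (ρ : ℕ → ℕ) : ℕ → ℕ
  | 0 => 0
  | i + 1 => ρ i + 1

/-- Renaming of free variables. -/
def rename : (ℕ → ℕ) → Tm → Tm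
  | ρ, var i => var (ρ i)
  | ρ, lam M => lam (rename (upr ρ) M)
  | ρ, app M N => app (rename ρ M) (rename ρ N)
  | ρ, bang M => bang (rename ρ M)
  | ρ, letb N M => letb (rename ρ N) (rename (upr ρ) M)

/-- Extension of a substitution below one binder. -/
def ups (σ : ℕ → Tm) : ℕ → Tm
  | 0 => var 0
  | i + 1 => rename Nat.succ (σ i)

/-- Simultaneous capture-avoiding substitution. -/
def subst : (ℕ → Tm) → Tm → Tm
  | σ, var i => σ i
  | σ, lam M => lam (subst (ups σ) M)
  | σ, app M N => app (subst σ M) (subst σ N)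
  | σ, bang M => bang (subst σ M)
  | σ, letb N M => letb (subst σ N) (subst (ups σ) M)

/-- The substitution sending variable `0` to `N` and decreasing the other variables. -/
def single (N : Tm) : ℕ → Tm
  | 0 => N
  | i + 1 => var i

/-- `M[N/x]`, where `x` is the variable `0` of `M`. -/
def inst (M N : Tm) : Tm := subst (single N) M

/-- The number of free occurrences of the variable `x` in a term. -/
def occ : ℕ → Tm → ℕ
  | x, var i => if i = x then 1 else 0
  | x, lam M => occ (x + 1) M
  | x, app M N => occ x M + occ x N
  | x, bang M => occ x M
  | x, letb N M => occ x N + occ (x + 1) M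

/-- `!^p M`. -/
def bangs (p : ℕ) (M : Tm) : Tm := bang^[p] M

/-- The iterated application `F M₁ … M_k`. -/
def apps {k : ℕ} (F : Tm) (M : Fin k → Tm) : Tm := (List.ofFn M).foldl app F

/-- The Church numeral `λf. let !f = f in !(λx. f (⋯ (f x) ⋯))`, with `n` applications of `f`. -/
def numeral (n : ℕ) : Tm :=
  lam (letb (var 0) (bang (lam ((app (var 1))^[n] (var 0)))))

end Tm

/-- One step of strong reduction: the rules `(λx.M) N → M[N/x]` and
`let !x = !N in M → M[N/x]`, applied in an arbitrary context. -/
inductive Step : Tm → Tm → Prop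
  | beta (M N : Tm) : Step (Tm.app (Tm.lam M) N) (Tm.inst M N)
  | letBang (M N : Tm) : Step (Tm.letb (Tm.bang N) M) (Tm.inst M N)
  | lam {M M' : Tm} : Step M M' → Step (Tm.lam M) (Tm.lam M')
  | appL {M M' : Tm} (N : Tm) : Step M M' → Step (Tm.app M N) (Tm.app M' N)
  | appR (M : Tm) {N N' : Tm} : Step N N' → Step (Tm.app M N) (Tm.app M N')
  | bang {M M' : Tm} : Step M M' → Step (Tm.bang M) (Tm.bang M')
  | letL {N N' : Tm} (M : Tm) : Step N N' → Step (Tm.letb N M) (Tm.letb N' M)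
  | letR (N : Tm) {M M' : Tm} : Step M M' → Step (Tm.letb N M) (Tm.letb N M')

/-- The reflexive and transitive closure of strong reduction. -/
abbrev Steps : Tm → Tm → Prop := Relation.ReflTransGen Step

/-- Types of the functional fragment, up to renaming of bound type variables
(de Bruijn indices): `t`, `1`, `A ⊸ B`, `!A` and `∀t.A`. -/
inductive Ty : Type
  | var : ℕ → Ty
  | one : Ty
  | arr : Ty → Ty → Ty
  | bang : Ty → Ty
  | all : Ty → Ty

namespace Ty

/-- Renaming of free type variables. -/
def rename : (ℕ → ℕ) → Ty → Ty
  | ρ, var i => var (ρ i)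
  | _, one => one
  | ρ, arr A B => arr (rename ρ A) (rename ρ B)
  | ρ, bang A => bang (rename ρ A)
  | ρ, all A => all (rename (Tm.upr ρ) A)

/-- Extension of a type substitution below one quantifier. -/
def ups (σ : ℕ → Ty) : ℕ → Ty
  | 0 => var 0
  | i + 1 => rename Nat.succ (σ i)

/-- Simultaneous capture-avoiding substitution in types. -/
def subst : (ℕ → Ty) → Ty → Ty
  | σ, var i => σ i
  | _, one => one
  | σ, arr A B => arr (subst σ A) (subst σ B)
  | σ, bang A => bang (subst σ A)
  | σ, all A => all (subst (ups σ) A)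

/-- The substitution sending type variable `0` to `B` and decreasing the others. -/
def single (B : Ty) : ℕ → Ty
  | 0 => B
  | i + 1 => var i

/-- `A[B/t]`, where `t` is the type variable `0` of `A`. -/
def inst (A B : Ty) : Ty := subst (single B) A

/-- `!^p A`. -/
def bangs (p : ℕ) (A : Ty) : Ty := bang^[p] A

/-- The type of numerals `N = ∀t. !(t ⊸ t) ⊸ !(t ⊸ t)`. -/
def nat : Ty :=
  all (arr (bang (arr (var 0) (var 0))) (bang (arr (var 0) (var 0))))

/-- The type `N ⊸ ⋯ ⊸ N ⊸ A` with `k` arguments of type `N`. -/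
def natFun (k : ℕ) (A : Ty) : Ty := (arr nat)^[k] A

end Ty

/-- Variable contexts: the variable `i` has the depth and the type at position `i`. -/
abbrev Ctx := List (ℕ × Ty)

/-- Weakening of every type of a context by a fresh type variable `0`. -/
def Ctx.shift (Γ : Ctx) : Ctx := Γ.map (fun h => (h.1, h.2.rename Nat.succ))

/-- The judgement `Γ ⊢^δ M : A` of the elementary affine type system, for the functional fragment
(empty region context). In `gen`, shifting the context expresses that the generalized type
variable does not occur free in it. -/
inductive HasType : Ctx → ℕ → Tm → Ty → Prop
  | var {Γ : Ctx} {δ i : ℕ} {A : Ty} :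
      Γ[i]? = some (δ, A) → HasType Γ δ (Tm.var i) A
  | lam {Γ : Ctx} {δ : ℕ} {M : Tm} {A B : Ty} :
      Tm.occ 0 M ≤ 1 → HasType ((δ, A) :: Γ) δ M B → HasType Γ δ (Tm.lam M) (Ty.arr A B)
  | app {Γ : Ctx} {δ : ℕ} {M N : Tm} {A B : Ty} :
      HasType Γ δ M (Ty.arr A B) → HasType Γ δ N A → HasType Γ δ (Tm.app M N) B
  | bang {Γ : Ctx} {δ : ℕ} {M : Tm} {A : Ty} :
      HasType Γ (δ + 1) M A → HasType Γ δ (Tm.bang M) (Ty.bang A)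
  | letb {Γ : Ctx} {δ : ℕ} {M N : Tm} {A B : Ty} :
      HasType Γ δ M (Ty.bang A) → HasType ((δ + 1, A) :: Γ) δ N B →
        HasType Γ δ (Tm.letb M N) B
  | gen {Γ : Ctx} {δ : ℕ} {M : Tm} {A : Ty} :
      HasType (Ctx.shift Γ) δ M A → HasType Γ δ M (Ty.all A)
  | spec {Γ : Ctx} {δ : ℕ} {M : Tm} {A : Ty} (B : Ty) :
      HasType Γ δ M (Ty.all A) → HasType Γ δ M (Ty.inst A B)

/-- The closed term `M`, of type `!^p N` at depth `δ`, represents the number `n`: it reduces by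
strong reduction to the numeral of `n` under `p` bangs. For `p = 0` this is the representation of
`n` by a term of type `N`. -/
def RepresentsNat (δ p : ℕ) (M : Tm) (n : ℕ) : Prop :=
  HasType [] δ M (Ty.bangs p Ty.nat) ∧ Steps M (Tm.bangs p (Tm.numeral n))

/-- The closed term `F`, of type `N ⊸ ⋯ ⊸ N ⊸ !^p N` at depth `δ`, represents the `k`-ary
function `f`. -/
def RepresentsFun (δ p : ℕ) {k : ℕ} (F : Tm) (f : (Fin k → ℕ) → ℕ) : Prop :=
  HasType [] δ F (Ty.natFun k (Ty.bangs p Ty.nat)) ∧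
    ∀ (M : Fin k → Tm) (n : Fin k → ℕ), (∀ i, RepresentsNat δ 0 (M i) (n i)) →
      RepresentsNat δ p (Tm.apps F M) (f n)

/-- Elementary functions: the smallest class of functions `ℕ^k → ℕ` that contains zero, successor,
projections and (truncated) subtraction and is closed under composition, bounded sums
`∑_{1 ≤ i ≤ n} f(i, x₁, …, x_k)` and bounded products `∏_{1 ≤ i ≤ n} f(i, x₁, …, x_k)`. -/
inductive Elementary : ∀ {k : ℕ}, ((Fin k → ℕ) → ℕ) → Prop
  | zero (k : ℕ) : Elementary (fun _ : Fin k → ℕ => 0)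
  | succ : Elementary (fun x : Fin 1 → ℕ => x 0 + 1)
  | proj {k : ℕ} (i : Fin k) : Elementary (fun x : Fin k → ℕ => x i)
  | sub : Elementary (fun x : Fin 2 → ℕ => x 0 - x 1)
  | comp {m k : ℕ} {g : (Fin m → ℕ) → ℕ} {f : Fin m → (Fin k → ℕ) → ℕ} :
      Elementary g → (∀ j, Elementary (f j)) →
        Elementary (fun x : Fin k → ℕ => g (fun j => f j x))
  | bsum {k : ℕ} {f : (Fin (k + 1) → ℕ) → ℕ} : Elementary f →
      Elementary (fun x : Fin (k + 1) → ℕ =>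
        ∑ i ∈ Finset.Icc 1 (x 0), f (Fin.cons i (Fin.tail x)))
  | bprod {k : ℕ} {f : (Fin (k + 1) → ℕ) → ℕ} : Elementary f →
      Elementary (fun x : Fin (k + 1) → ℕ =>
        ∏ i ∈ Finset.Icc 1 (x 0), f (Fin.cons i (Fin.tail x)))

end EA

/-! A `λ`-bound variable may occur only once, but a `let !`-bound one may occur freely, one level
deeper. A numeral can cross that level: iterating the successor under a bang coerces `N` to `!N`
(`coerc`). Hence it suffices to compute `f` by an open term whose variables of type `N` are used
without restriction (`Computes`). Coercing every argument first turns such a term into a closed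
function at the price of one bang (`Computes.exists_closed`), and composition applies closed
functions under bangs after equalizing the bangs of the inner terms.

Bounded sums and products are the hard case (`Computes.fold`). An iteration passing a counter along
would use it twice in each step, once in `f` and once for its successor, which affinity rules out.
Instead the list `[1, …, n]` is built beforehand as a Church-style list, by iterating `l ↦ 1 :: map
succ l` from the empty list. Folding it with `a, r ↦ op (f (a, x)) r`, at the accumulator type `!^q
N`, uses each index once (`Steps.list_bang`). -/

namespace EA

open Tm

/-! ### Substitution calculus -/

namespace Tm

/-- The substitution sending variable `0` to `N` and the variable `i + 1` to `σ i`. -/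
def scons (N : Tm) (σ : ℕ → Tm) : ℕ → Tm
  | 0 => N
  | i + 1 => σ i

/-- A term that is invariant under all substitutions. -/
def Closed (M : Tm) : Prop := ∀ σ, subst σ M = M

theorem rename_eq_subst (ρ : ℕ → ℕ) (M : Tm) : rename ρ M = subst (fun i => var (ρ i)) M := by
  have h : ∀ ρ : ℕ → ℕ, ups (fun i => var (ρ i)) = fun i => var (upr ρ i) := by
    intro ρ; funext i; cases i <;> rfl
  induction M generalizing ρ <;> simp_all [rename, subst]

theorem subst_rename (σ : ℕ → Tm) (ρ : ℕ → ℕ) (M : Tm) :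
    subst σ (rename ρ M) = subst (fun i => σ (ρ i)) M := by
  have h : ∀ (σ : ℕ → Tm) (ρ : ℕ → ℕ), (fun i => ups σ (upr ρ i)) = ups (fun i => σ (ρ i)) := by
    intro σ ρ; funext i; cases i <;> rfl
  induction M generalizing ρ σ <;> simp_all [rename, subst]

theorem rename_rename (ρ ρ' : ℕ → ℕ) (M : Tm) :
    rename ρ (rename ρ' M) = rename (fun i => ρ (ρ' i)) M := by
  rw [rename_eq_subst ρ, subst_rename, ← rename_eq_subst]

theorem rename_subst (ρ : ℕ → ℕ) (σ : ℕ → Tm) (M : Tm) :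
    rename ρ (subst σ M) = subst (fun i => rename ρ (σ i)) M := by
  have h : ∀ (ρ : ℕ → ℕ) (σ : ℕ → Tm),
      (fun i => rename (upr ρ) (ups σ i)) = ups (fun i => rename ρ (σ i)) := by
    intro ρ σ; funext i
    cases i with
    | zero => rfl
    | succ i => simp only [ups, rename_rename]; rfl
  induction M generalizing ρ σ <;> simp_all [rename, subst]

theorem subst_subst (τ σ : ℕ → Tm) (M : Tm) :
    subst τ (subst σ M) = subst (fun i => subst τ (σ i)) M := by
  have h : ∀ (τ σ : ℕ → Tm), (fun i => subst (ups τ) (ups σ i)) = ups (fun i => subst τ (σ i)) := by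
    intro τ σ; funext i
    cases i with
    | zero => rfl
    | succ i => simp only [ups, subst_rename, rename_subst]
  induction M generalizing τ σ <;> simp_all [subst]

theorem subst_var (M : Tm) : subst var M = M := by
  have h : ups var = var := by funext i; cases i <;> rfl
  induction M <;> simp_all [subst]

theorem inst_rename_succ (M N : Tm) : inst (rename Nat.succ M) N = M := by
  rw [inst, subst_rename]; exact subst_var M

/-- Lets a redex below a pending substitution be contracted by extending the environment `σ`, so
that long reductions never compute nested substitutions. -/
theorem inst_subst_ups (σ : ℕ → Tm) (M N : Tm) :
    inst (subst (ups σ) M) N = subst (scons N σ) M := by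
  rw [inst, subst_subst]
  congr 1; funext i
  cases i with
  | zero => rfl
  | succ i => exact inst_rename_succ _ _

theorem Closed.rename {M : Tm} (h : Closed M) (ρ : ℕ → ℕ) : rename ρ M = M := by
  rw [rename_eq_subst, h]

theorem subst_iterate_app (σ : ℕ → Tm) (F M : Tm) (n : ℕ) :
    subst σ ((app F)^[n] M) = (app (subst σ F))^[n] (subst σ M) := by
  induction n with
  | zero => rfl
  | succ n ih => rw [Function.iterate_succ_apply', Function.iterate_succ_apply', subst, ih]

theorem rename_iterate_app (ρ : ℕ → ℕ) (F M : Tm) (n : ℕ) :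
    rename ρ ((app F)^[n] M) = (app (rename ρ F))^[n] (rename ρ M) := by
  simp only [rename_eq_subst, subst_iterate_app]

theorem Closed.iterate_app {F M : Tm} (hF : Closed F) (hM : Closed M) (n : ℕ) :
    Closed ((app F)^[n] M) := fun σ => by rw [subst_iterate_app, hF, hM]

theorem closed_numeral (n : ℕ) : Closed (numeral n) := fun σ => by
  simp [numeral, subst, subst_iterate_app, ups, rename]

theorem bangs_zero (M : Tm) : bangs 0 M = M := rfl

theorem bangs_succ (p : ℕ) (M : Tm) : bangs (p + 1) M = bang (bangs p M) :=
  Function.iterate_succ_apply' _ _ _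

theorem bangs_add (p q : ℕ) (M : Tm) : bangs (p + q) M = bangs p (bangs q M) :=
  Function.iterate_add_apply _ _ _ _

theorem Closed.bangs {M : Tm} (h : Closed M) (p : ℕ) : Closed (bangs p M) := fun σ => by
  induction p with
  | zero => exact h σ
  | succ p ih => rw [bangs_succ, subst, ih]

theorem subst_foldl_app (σ : ℕ → Tm) (l : List Tm) (F : Tm) :
    subst σ (l.foldl app F) = (l.map (subst σ)).foldl app (subst σ F) := by
  induction l generalizing F with
  | nil => rfl
  | cons N l ih => simp only [List.foldl_cons, List.map_cons, ih, subst]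

theorem subst_apps (σ : ℕ → Tm) {k : ℕ} (F : Tm) (M : Fin k → Tm) :
    subst σ (apps F M) = apps (subst σ F) (fun i => subst σ (M i)) := by
  rw [apps, subst_foldl_app, List.map_ofFn]; rfl

theorem occ_foldl_app (x : ℕ) (l : List Tm) (F : Tm) :
    occ x (l.foldl app F) = occ x F + (l.map (occ x)).sum := by
  induction l generalizing F with
  | nil => rfl
  | cons N l ih => simp only [List.foldl_cons, List.map_cons, ih, occ, List.sum_cons]; omega

theorem occ_iterate_lam (k x : ℕ) (M : Tm) : occ x (lam^[k] M) = occ (x + k) M := by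
  induction k generalizing x with
  | zero => rfl
  | succ k ih => rw [Function.iterate_succ_apply', occ, ih]; congr 1; omega

end Tm

namespace Ty

theorem bangs_succ (p : ℕ) (A : Ty) : bangs (p + 1) A = bang (bangs p A) :=
  Function.iterate_succ_apply' _ _ _

theorem bangs_add (p q : ℕ) (A : Ty) : bangs (p + q) A = bangs p (bangs q A) :=
  Function.iterate_add_apply _ _ _ _

theorem natFun_succ (k : ℕ) (A : Ty) : natFun (k + 1) A = arr nat (natFun k A) :=
  Function.iterate_succ_apply' _ _ _

end Ty

/-! ### Congruence rules for strong reduction -/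

namespace Steps

theorem beta {M N P : Tm} (h : inst M N = P) : Steps (app (lam M) N) P :=
  h ▸ .single (.beta M N)

theorem letBang {M N P : Tm} (h : inst M N = P) : Steps (letb (bang N) M) P :=
  h ▸ .single (.letBang M N)

theorem map (f : Tm → Tm) (hf : ∀ {M M'}, Step M M' → Step (f M) (f M')) {M M' : Tm}
    (h : Steps M M') : Steps (f M) (f M') := by
  induction h with
  | refl => exact .refl
  | tail _ h ih => exact ih.tail (hf h)

theorem lam {M M' : Tm} (h : Steps M M') : Steps (lam M) (lam M') :=
  map _ .lam h

theorem bang {M M' : Tm} (h : Steps M M') : Steps (bang M) (bang M') :=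
  map _ .bang h

theorem app {M M' N N' : Tm} (h : Steps M M') (h' : Steps N N') : Steps (app M N) (app M' N') :=
  (map (fun M => Tm.app M N) (.appL N) h).trans
    (map (Tm.app M') (.appR M') h')

theorem letb {M M' N N' : Tm} (h : Steps N N') (h' : Steps M M') :
    Steps (letb N M) (letb N' M') :=
  (map (fun N => Tm.letb N M) (.letL M) h).trans
    (map (Tm.letb N') (.letR N') h')

theorem appL {M M' : Tm} (N : Tm) (h : Steps M M') : Steps (Tm.app M N) (Tm.app M' N) := h.app .refl

theorem appR (M : Tm) {N N' : Tm} (h : Steps N N') : Steps (Tm.app M N) (Tm.app M N') :=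
  Steps.app .refl h

theorem letL {N N' : Tm} (M : Tm) (h : Steps N N') : Steps (Tm.letb N M) (Tm.letb N' M) :=
  h.letb .refl

theorem letR (N : Tm) {M M' : Tm} (h : Steps M M') : Steps (Tm.letb N M) (Tm.letb N M') :=
  Steps.letb .refl h

theorem bangs (p : ℕ) {M M' : Tm} (h : Steps M M') : Steps (bangs p M) (bangs p M') := by
  induction p with
  | zero => exact h
  | succ p ih => rw [bangs_succ, bangs_succ]; exact ih.bang

theorem apps {k : ℕ} {F F' : Tm} {M M' : Fin k → Tm} (hF : Steps F F')
    (hM : ∀ i, Steps (M i) (M' i)) : Steps (apps F M) (apps F' M') := by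
  induction k generalizing F F' with
  | zero => simpa [Tm.apps] using hF
  | succ k ih =>
    simp only [Tm.apps, List.ofFn_succ, List.foldl_cons]
    exact ih (hF.app (hM 0)) fun i => hM i.succ

theorem iterate_app {F : Tm} {M : ℕ → Tm} (h : ∀ j, Steps (Tm.app F (M j)) (M (j + 1))) (n : ℕ) :
    Steps ((Tm.app F)^[n] (M 0)) (M n) := by
  induction n with
  | zero => exact .refl
  | succ n ih => rw [Function.iterate_succ_apply']; exact (appR F ih).trans (h n)

theorem iterate_app_right (F : Tm) (n : ℕ) {M M' : Tm} (h : Steps M M') :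
    Steps ((Tm.app F)^[n] M) ((Tm.app F)^[n] M') := by
  induction n with
  | zero => exact h
  | succ n ih => rw [Function.iterate_succ_apply', Function.iterate_succ_apply']; exact appR F ih

/-- Reduction of a numeral that is applied to a boxed term. -/
theorem numeral_bang (n : ℕ) (M : Tm) :
    Steps (Tm.app (numeral n) (Tm.bang M))
      (Tm.bang (Tm.lam ((Tm.app (rename Nat.succ M))^[n] (var 0)))) := by
  refine (beta rfl).trans (letBang ?_)
  simp [inst, subst, subst_iterate_app, ups, single, rename]

theorem numeral_bang_closed (n : ℕ) {M : Tm} (hM : Closed M) :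
    Steps (Tm.app (numeral n) (Tm.bang M)) (Tm.bang (Tm.lam ((Tm.app M)^[n] (var 0)))) := by
  simpa only [hM.rename] using numeral_bang n M

theorem lam_iterate_app (n : ℕ) {M : Tm} (hM : Closed M) (N : Tm) :
    Steps (Tm.app (Tm.lam ((Tm.app M)^[n] (var 0))) N) ((Tm.app M)^[n] N) :=
  beta (by rw [inst, subst_iterate_app, hM]; rfl)

end Steps

/-! ### Typing: weakening and closedness -/

namespace HasType

theorem weaken {Γ : Ctx} {δ : ℕ} {M : Tm} {A : Ty} (h : HasType Γ δ M A) (Δ : Ctx) :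
    HasType (Γ ++ Δ) δ M A := by
  induction h generalizing Δ with
  | var h => exact .var (by rw [List.getElem?_append_left (List.getElem?_eq_some_iff.1 h).1, h])
  | lam h _ ih => exact .lam h (ih Δ)
  | app _ _ ih ih' => exact .app (ih Δ) (ih' Δ)
  | bang _ ih => exact .bang (ih Δ)
  | letb _ _ ih ih' => exact .letb (ih Δ) (ih' Δ)
  | gen _ ih => exact .gen (by simpa only [Ctx.shift, List.map_append] using ih (Ctx.shift Δ))
  | spec B _ ih => exact .spec B (ih Δ)

theorem closed_weaken {δ : ℕ} {M : Tm} {A : Ty} (h : HasType [] δ M A) (Γ : Ctx) :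
    HasType Γ δ M A := h.weaken Γ

theorem occ_eq_zero {Γ : Ctx} {δ : ℕ} {M : Tm} {A : Ty} (h : HasType Γ δ M A) {x : ℕ}
    (hx : Γ.length ≤ x) : occ x M = 0 := by
  induction h generalizing x with
  | var h =>
    have := (List.getElem?_eq_some_iff.1 h).1
    exact if_neg (by omega)
  | lam h _ ih => exact ih (by simpa using hx)
  | app _ _ ih ih' => rw [occ, ih hx, ih' hx]
  | bang _ ih => exact ih hx
  | letb _ _ ih ih' => rw [occ, ih hx, ih' (by simpa using hx)]
  | gen _ ih => exact ih (by simpa [Ctx.shift] using hx)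
  | spec B _ ih => exact ih hx

/-- A typed term has its free variables in its context. Closedness of the combinators is thus read
off from their typings in the empty context. -/
theorem subst_congr {Γ : Ctx} {δ : ℕ} {M : Tm} {A : Ty} (h : HasType Γ δ M A) {σ τ : ℕ → Tm}
    (hστ : ∀ i < Γ.length, σ i = τ i) : subst σ M = subst τ M := by
  have up : ∀ {n : ℕ} {σ τ : ℕ → Tm}, (∀ i < n, σ i = τ i) → ∀ i < n + 1, ups σ i = ups τ i := by
    intro n σ τ h i hi
    cases i with
    | zero => rfl
    | succ i => simp only [ups, h i (by omega)]
  induction h generalizing σ τ with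
  | var h => exact hστ _ (List.getElem?_eq_some_iff.1 h).1
  | lam h _ ih => rw [subst, subst, ih (up hστ)]
  | app _ _ ih ih' => rw [subst, subst, ih hστ, ih' hστ]
  | bang _ ih => rw [subst, subst, ih hστ]
  | letb _ _ ih ih' => rw [subst, subst, ih hστ, ih' (up hστ)]
  | gen _ ih => exact ih (by simpa [Ctx.shift] using hστ)
  | spec B _ ih => exact ih hστ

theorem closed_subst {Γ : Ctx} {δ : ℕ} {M : Tm} {A : Ty} (h : HasType Γ δ M A) {σ : ℕ → Tm}
    (hσ : ∀ i < Γ.length, Closed (σ i)) : Closed (subst σ M) := fun τ => by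
  rw [subst_subst]; exact h.subst_congr fun i hi => hσ i hi τ

theorem closed {δ : ℕ} {M : Tm} {A : Ty} (h : HasType [] δ M A) : Closed M := fun σ => by
  rw [h.subst_congr (τ := Tm.var) (by simp), subst_var]

theorem nat_spec {Γ : Ctx} {δ : ℕ} {M : Tm} (h : HasType Γ δ M Ty.nat) (B : Ty) :
    HasType Γ δ M (.arr (.bang (.arr B B)) (.bang (.arr B B))) := .spec B h

theorem bangs {Γ : Ctx} {δ p : ℕ} {M : Tm} {A : Ty} (h : HasType Γ (δ + p) M A) :
    HasType Γ δ (bangs p M) (Ty.bangs p A) := by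
  induction p generalizing δ with
  | zero => exact h
  | succ p ih =>
    rw [Tm.bangs_succ, Ty.bangs_succ]
    exact .bang (ih (by rwa [show δ + 1 + p = δ + (p + 1) by omega]))

theorem apps {Γ : Ctx} {δ k : ℕ} {F : Tm} {A : Ty} {M : Fin k → Tm}
    (hF : HasType Γ δ F (Ty.natFun k A)) (hM : ∀ i, HasType Γ δ (M i) Ty.nat) :
    HasType Γ δ (apps F M) A := by
  induction k generalizing F with
  | zero => simpa [Tm.apps, Ty.natFun] using hF
  | succ k ih =>
    simp only [Tm.apps, List.ofFn_succ, List.foldl_cons]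
    rw [Ty.natFun_succ] at hF
    exact ih (.app hF (hM 0)) fun i => hM i.succ

end HasType

/-! ### Arithmetic and bang combinators -/

namespace Tm

/-- The successor, of type `N ⊸ N`. -/
def succ : Tm :=
  lam (lam (letb (var 0) (letb (app (var 2) (bang (var 0)))
    (bang (lam (app (var 2) (app (var 1) (var 0))))))))

/-- The predecessor, of type `N ⊸ N`. -/
def pred : Tm :=
  lam (lam (letb (var 0)
    (letb (app (var 2) (bang (lam (lam (app (var 0) (app (var 1) (var 2)))))))
      (bang (lam (app (app (var 1) (lam (var 1))) (lam (var 0))))))))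

/-- Addition, of type `N ⊸ N ⊸ N`. -/
def add : Tm :=
  lam (lam (lam (letb (var 0) (letb (app (var 3) (bang (var 0)))
    (letb (app (var 3) (bang (var 1)))
      (bang (lam (app (var 2) (app (var 1) (var 0))))))))))

/-- Multiplication, of type `N ⊸ N ⊸ N`. -/
def mul : Tm :=
  lam (lam (lam (letb (var 0) (app (var 3) (app (var 2) (bang (var 0)))))))

/-- The coercion, of type `N ⊸ !N`. -/
def coerc : Tm := lam (letb (app (var 0) (bang succ)) (bang (app (var 0) (numeral 0))))

/-- The coercion under `p` bangs, of type `!^p N ⊸ !^(p+1) N`. -/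
def lift : ℕ → Tm
  | 0 => coerc
  | p + 1 => lam (letb (var 0) (bang (app (lift p) (var 0))))

/-- Application under `p` bangs, of type `!^p (A ⊸ B) ⊸ !^p A ⊸ !^p B`. -/
def appBangs : ℕ → Tm
  | 0 => lam (lam (app (var 1) (var 0)))
  | p + 1 => lam (lam (letb (var 1) (letb (var 1)
      (bang (app (app (appBangs p) (var 1)) (var 0))))))

end Tm

namespace HasType

theorem numeral (Γ : Ctx) (δ n : ℕ) : HasType Γ δ (numeral n) Ty.nat := by
  refine .gen (.lam ?_ (.letb (.var rfl) (.bang (.lam ?_ ?_))))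
  · suffices ∀ n, occ 2 ((Tm.app (Tm.var 1))^[n] (Tm.var 0)) = 0 by simp [occ, this]
    intro n
    induction n with
    | zero => rfl
    | succ n ih => rw [Function.iterate_succ_apply', occ, ih]; rfl
  · suffices ∀ n, occ 0 ((Tm.app (Tm.var 1))^[n] (Tm.var 0)) = 1 from (this n).le
    intro n
    induction n with
    | zero => rfl
    | succ n ih => rw [Function.iterate_succ_apply', occ, ih]; rfl
  · induction n with
    | zero => exact .var rfl
    | succ n ih => rw [Function.iterate_succ_apply']; exact .app (.var rfl) ih

theorem succ (Γ : Ctx) (δ : ℕ) : HasType Γ δ succ (.arr .nat .nat) :=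
  .lam (by decide) (.gen (.lam (by decide) (.letb (.var rfl)
    (.letb (.app (nat_spec (.var rfl) (.var 0)) (.bang (.var rfl)))
      (.bang (.lam (by decide) (.app (.var rfl) (.app (.var rfl) (.var rfl)))))))))

theorem pred (Γ : Ctx) (δ : ℕ) : HasType Γ δ pred (.arr .nat .nat) :=
  .lam (by decide) (.gen (.lam (by decide) (.letb (.var rfl)
    (.letb (.app (nat_spec (.var rfl) (.arr (.arr (.var 0) (.var 0)) (.var 0)))
        (.bang (.lam (by decide) (.lam (by decide)
          (.app (.var rfl) (.app (.var rfl) (.var rfl)))))))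
      (.bang (.lam (by decide) (.app (.app (.var rfl) (.lam (by decide) (.var rfl)))
        (.lam (by decide) (.var rfl)))))))))

theorem add (Γ : Ctx) (δ : ℕ) : HasType Γ δ add (.arr .nat (.arr .nat .nat)) :=
  .lam (by decide) (.lam (by decide) (.gen (.lam (by decide) (.letb (.var rfl)
    (.letb (.app (nat_spec (.var rfl) (.var 0)) (.bang (.var rfl)))
      (.letb (.app (nat_spec (.var rfl) (.var 0)) (.bang (.var rfl)))
        (.bang (.lam (by decide) (.app (.var rfl) (.app (.var rfl) (.var rfl)))))))))))

theorem mul (Γ : Ctx) (δ : ℕ) : HasType Γ δ mul (.arr .nat (.arr .nat .nat)) :=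
  .lam (by decide) (.lam (by decide) (.gen (.lam (by decide) (.letb (.var rfl)
    (.app (nat_spec (.var rfl) (.var 0))
      (.app (nat_spec (.var rfl) (.var 0)) (.bang (.var rfl))))))))

theorem coerc (Γ : Ctx) (δ : ℕ) : HasType Γ δ coerc (.arr .nat (.bang .nat)) :=
  .lam (by decide) (.letb (.app (nat_spec (.var rfl) .nat) (.bang (succ _ _)))
    (.bang (.app (.var rfl) (numeral _ _ _))))

theorem lift (Γ : Ctx) (δ p : ℕ) :
    HasType Γ δ (lift p) (.arr (Ty.bangs p .nat) (Ty.bangs (p + 1) .nat)) := by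
  induction p generalizing Γ δ with
  | zero => exact coerc Γ δ
  | succ p ih =>
    rw [Ty.bangs_succ, Ty.bangs_succ]
    have h : occ 1 (Tm.lift p) = 0 := (ih [] 0).occ_eq_zero (by simp)
    exact .lam (by simp [occ, h]) (.letb (.var rfl) (.bang (.app (ih _ _) (.var rfl))))

theorem appBangs (Γ : Ctx) (δ p : ℕ) (A B : Ty) :
    HasType Γ δ (appBangs p) (.arr (Ty.bangs p (.arr A B)) (.arr (Ty.bangs p A) (Ty.bangs p B))) := by
  induction p generalizing Γ δ with
  | zero => exact .lam (by decide) (.lam (by decide) (.app (.var rfl) (.var rfl)))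
  | succ p ih =>
    simp only [Ty.bangs_succ]
    have h : ∀ x, occ x (Tm.appBangs p) = 0 := fun x => (ih [] 0).occ_eq_zero (by simp)
    exact .lam (by simp [occ, h]) (.lam (by simp [occ, h]) (.letb (.var rfl) (.letb (.var rfl)
      (.bang (.app (.app (ih _ _) (.var rfl)) (.var rfl))))))

end HasType

namespace Tm

theorem closed_succ : Closed succ := (HasType.succ [] 0).closed

theorem closed_pred : Closed pred := (HasType.pred [] 0).closed

theorem closed_coerc : Closed coerc := (HasType.coerc [] 0).closed

theorem closed_lift (p : ℕ) : Closed (lift p) := (HasType.lift [] 0 p).closed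

theorem closed_appBangs (p : ℕ) : Closed (appBangs p) := (HasType.appBangs [] 0 p .one .one).closed

end Tm

namespace Steps

attribute [local simp] inst subst ups single rename upr subst_iterate_app rename_iterate_app

theorem succ (n : ℕ) : Steps (Tm.app succ (numeral n)) (numeral (n + 1)) := by
  refine (beta rfl).trans (lam (letR _ ?_))
  simp only [subst, ups, single, rename, (closed_numeral n).rename]
  refine (letL _ (numeral_bang n _)).trans ((letBang rfl).trans (bang (lam ?_)))
  rw [Function.iterate_succ_apply']
  exact appR _ (beta (by simp))

theorem add (m n : ℕ) :
    Steps (Tm.app (Tm.app add (numeral m)) (numeral n)) (numeral (m + n)) := by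
  refine (appL _ (beta rfl)).trans ((beta rfl).trans (lam (letR _ ?_)))
  simp only [subst, ups, single, rename, (closed_numeral _).rename, closed_numeral _ _]
  refine (letL _ (numeral_bang m _)).trans ((letBang rfl).trans ?_)
  simp only [inst, subst, ups, single, closed_numeral _ _]
  refine (letL _ (numeral_bang n _)).trans ((letBang rfl).trans ?_)
  simp only [inst, subst, ups, single, rename]
  refine bang (lam ((appR _ (beta rfl)).trans (beta ?_)))
  simp [Function.iterate_add_apply]

theorem mul (m n : ℕ) :
    Steps (Tm.app (Tm.app mul (numeral m)) (numeral n)) (numeral (m * n)) := by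
  refine (appL _ (beta rfl)).trans ((beta rfl).trans (lam (letR _ ?_)))
  simp only [subst, ups, single, rename, (closed_numeral _).rename, closed_numeral _ _]
  refine (appR _ (numeral_bang n _)).trans ((numeral_bang m _).trans (bang (lam ?_)))
  -- Each of the `m` copies of `λx. f^n x` adds `n` applications of `f`, so `j` copies give `f^(n *
  -- j) x`.
  have := iterate_app (F := .lam ((Tm.app (.var 2))^[n] (.var 0)))
    (M := fun j => (Tm.app (.var 1))^[n * j] (.var 0)) (fun j => beta ?_) m
  · simpa [mul_comm] using this
  · simp [← Function.iterate_add_apply, mul_add, add_comm]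

theorem pred (n : ℕ) : Steps (Tm.app pred (numeral n)) (numeral (n - 1)) := by
  refine (beta rfl).trans (lam (letR _ ?_))
  simp only [subst, ups, single, rename, (closed_numeral n).rename]
  refine (letL _ (numeral_bang n _)).trans ((letBang rfl).trans ?_)
  simp only [inst, subst, ups, single, rename, upr]
  refine bang (lam ((appL _ (beta rfl)).trans ?_))
  cases n with
  | zero => exact beta rfl
  | succ n =>
    -- The step `g ↦ λh. h (g f)` is iterated from the constant function `λ_. x`. The first step
    -- discards `f` and gives `λh. h x`; after `j` more it is `λh. h (f^j x)`. Applying the result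
    -- to the identity leaves one `f` fewer than the number of steps.
    have := iterate_app (F := .lam (.lam (.app (.var 0) (.app (.var 1) (.var 3)))))
      (M := fun j => .lam (.app (.var 0) ((Tm.app (.var 2))^[j] (.var 1))))
      (fun j => (beta rfl).trans (lam (appR _ (beta ?_)))) n
    · simp only [inst, rename_iterate_app, subst_iterate_app, Function.iterate_succ_apply]
      refine (appL _ ((iterate_app_right _ n ?_).trans this)).trans ?_
      · exact (beta rfl).trans (lam (appR _ (beta rfl)))
      · exact (beta rfl).trans (beta (by simp))
    · simp [Function.iterate_succ_apply']

theorem coerc (n : ℕ) : Steps (Tm.app coerc (numeral n)) (Tm.bang (numeral n)) := by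
  refine (beta rfl).trans ?_
  simp only [inst, subst, single, closed_succ _, closed_numeral _ _]
  refine (letL _ (numeral_bang_closed n closed_succ)).trans ((letBang rfl).trans (bang ?_))
  simp only [subst, closed_numeral _ _]
  exact (lam_iterate_app n closed_succ _).trans (iterate_app succ n)

theorem lift (p n : ℕ) :
    Steps (Tm.app (lift p) (Tm.bangs p (numeral n))) (Tm.bangs (p + 1) (numeral n)) := by
  induction p with
  | zero => exact coerc n
  | succ p ih =>
    rw [Tm.bangs_succ, Tm.bangs_succ]
    refine (beta rfl).trans ((letBang rfl).trans (bang ?_))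
    simpa only [subst, single, ups, closed_lift _ _] using ih

theorem appBangs (p : ℕ) {M N : Tm} (hM : Closed M) (hN : Closed N) :
    Steps (Tm.app (Tm.app (appBangs p) (Tm.bangs p M)) (Tm.bangs p N))
      (Tm.bangs p (Tm.app M N)) := by
  induction p with
  | zero =>
    refine (appL _ (beta rfl)).trans (beta ?_)
    simp only [inst, subst, ups, single, hM.rename, hM _, Tm.bangs_zero]
  | succ p ih =>
    simp only [Tm.bangs_succ]
    refine (appL _ (beta rfl)).trans ((beta rfl).trans ?_)
    simp only [inst, subst, ups, single, rename, (hM.bangs p).rename, closed_appBangs p _]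
    refine (letBang rfl).trans ?_
    simp only [inst, subst, ups, single, (hM.bangs p).rename, (hN.bangs p).rename,
      hN.bangs p _, hM.bangs p _, closed_appBangs p _]
    refine (letBang rfl).trans (bang ?_)
    simpa only [subst, ups, single, rename, (hN.bangs p).rename,
      hN.bangs p _, hM.bangs p _, closed_appBangs p _] using ih

end Steps

/-! ### Coercing and applying several arguments -/

namespace Tm

/-- `let !y_b = coerc x_b in ⋯` for all `b < k`, where `x_b` is the variable `idx b`: inside of `M`,
the variable `k - 1 - b` is a copy of `x_b` one level deeper. -/
def wrap (idx : ℕ → ℕ) : ℕ → Tm → Tm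
  | 0, M => M
  | k + 1, M => wrap idx k (letb (app coerc (var (k + idx k))) M)

/-- Iterated application under `p` bangs. -/
def appsBangs (p : ℕ) : {m : ℕ} → Tm → (Fin m → Tm) → Tm
  | 0, F, _ => F
  | _ + 1, F, M => appsBangs p (app (app (appBangs p) F) (M 0)) (fun i => M i.succ)

theorem subst_appsBangs (σ : ℕ → Tm) (p : ℕ) {m : ℕ} (F : Tm) (M : Fin m → Tm) :
    subst σ (appsBangs p F M) = appsBangs p (subst σ F) (fun i => subst σ (M i)) := by
  induction m generalizing F with
  | zero => rfl
  | succ m ih => simp only [appsBangs, ih, subst, closed_appBangs p _]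

theorem occ_apps (x : ℕ) {k : ℕ} (F : Tm) (M : Fin k → Tm) :
    occ x (apps F M) = occ x F + ∑ i, occ x (M i) := by
  rw [apps, occ_foldl_app, List.map_ofFn, List.sum_ofFn]; rfl

/-- The coercion of a variable is its only use outside `M`; this yields the affinity condition when
the variables are abstracted. -/
theorem occ_wrap_id (k x : ℕ) (M : Tm) :
    occ x (wrap id k M) = (if x < k then 1 else 0) + occ (x + k) M := by
  induction k generalizing M with
  | zero => simp [wrap]
  | succ k ih =>
    have h : occ (x + k) coerc = 0 := (HasType.coerc [] 0).occ_eq_zero (by simp)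
    simp only [wrap, ih, occ, id, h, ← add_assoc, zero_add]
    split_ifs <;> omega

end Tm

namespace HasType

theorem wrap {Γ : Ctx} {δ : ℕ} {idx : ℕ → ℕ} {k : ℕ} {M : Tm} {A : Ty}
    (hidx : ∀ b < k, Γ[idx b]? = some (δ, Ty.nat))
    (h : HasType (List.replicate k (δ + 1, Ty.nat) ++ Γ) δ M A) : HasType Γ δ (wrap idx k M) A := by
  induction k generalizing M with
  | zero => exact h
  | succ k ih =>
    refine ih (fun b hb => hidx b (by omega)) (.letb (.app (coerc _ _) (.var ?_)) h)
    rw [List.getElem?_append_right (by simp)]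
    simpa using hidx k (by omega)

theorem iterate_lam {Γ : Ctx} {δ k : ℕ} {M : Tm} {A : Ty} (hocc : ∀ j < k, occ j M ≤ 1)
    (h : HasType (List.replicate k (δ, Ty.nat) ++ Γ) δ M A) :
    HasType Γ δ (Tm.lam^[k] M) (Ty.natFun k A) := by
  induction k generalizing Γ with
  | zero => exact h
  | succ k ih =>
    rw [Function.iterate_succ_apply', Ty.natFun_succ]
    refine .lam ?_ (ih (fun j hj => hocc j (by omega)) ?_)
    · rw [occ_iterate_lam, zero_add]; exact hocc k (by omega)
    · simpa [List.replicate_succ'] using h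

theorem appsBangs {Γ : Ctx} {δ p m : ℕ} {F : Tm} {A : Ty} {M : Fin m → Tm}
    (hF : HasType Γ δ F (Ty.bangs p (Ty.natFun m A)))
    (hM : ∀ i, HasType Γ δ (M i) (Ty.bangs p Ty.nat)) :
    HasType Γ δ (appsBangs p F M) (Ty.bangs p A) := by
  induction m generalizing F with
  | zero => exact hF
  | succ m ih =>
    rw [Ty.natFun_succ] at hF
    exact ih (.app (.app (appBangs _ _ _ _ _) hF) (hM 0)) fun i => hM i.succ

end HasType

namespace Steps

/-- Later bindings receive smaller indices, so the copies come out in reverse order: hence `b.rev`.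
-/
theorem wrap (σ : ℕ → Tm) (idx : ℕ → ℕ) (k : ℕ) (M : Tm) (n : Fin k → ℕ)
    (h : ∀ b : Fin k, σ (idx b) = numeral (n b.rev)) :
    ∃ τ : ℕ → Tm, Steps (subst σ (wrap idx k M)) (subst τ M) ∧
      (∀ i : Fin k, τ i = numeral (n i)) ∧ ∀ i, τ (k + i) = σ i := by
  induction k generalizing M with
  | zero => exact ⟨σ, .refl, fun i => i.elim0, fun i => by rw [zero_add]⟩
  | succ k ih =>
    obtain ⟨τ, hs, hlt, hge⟩ := ih (Tm.letb (Tm.app Tm.coerc (var (k + idx k))) M) (fun i => n i.succ)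
      fun b => by rw [← Fin.rev_castSucc]; exact h b.castSucc
    have hk : σ (idx k) = numeral (n 0) := by simpa using h (Fin.last k)
    refine ⟨scons (numeral (n 0)) τ, hs.trans ?_, fun i => ?_, fun i => ?_⟩
    · rw [subst, subst, closed_coerc _, subst, hge, hk, ← inst_subst_ups]
      exact (letL _ (coerc _)).trans (letBang rfl)
    · refine Fin.cases rfl (fun i => ?_) i
      exact hlt i
    · rw [Nat.add_right_comm]; exact hge i

theorem apps_iterate_lam (σ : ℕ → Tm) {k : ℕ} (M : Tm) (N : Fin k → Tm) :
    ∃ τ : ℕ → Tm, Steps (Tm.apps (subst σ (Tm.lam^[k] M)) N) (subst τ M) ∧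
      (∀ i : Fin k, τ i.rev = N i) ∧ ∀ i, τ (k + i) = σ i := by
  induction k generalizing σ with
  | zero => exact ⟨σ, .refl, fun i => i.elim0, fun i => by rw [zero_add]⟩
  | succ k ih =>
    obtain ⟨τ, hs, hlt, hge⟩ := ih (scons (N 0) σ) fun i => N i.succ
    refine ⟨τ, .trans ?_ hs, fun i => ?_, fun i => ?_⟩
    · simp only [Function.iterate_succ_apply', Tm.apps, List.ofFn_succ, List.foldl_cons, subst]
      exact apps (beta (inst_subst_ups _ _ _)) fun i => .refl
    · refine Fin.cases ?_ (fun i => ?_) i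
      · simpa [scons] using hge 0
      · rw [Fin.rev_succ]; exact hlt i
    · rw [Nat.add_right_comm]; exact hge (i + 1)

theorem appsBangs {p m : ℕ} {F F' : Tm} {M N : Fin m → Tm} (hF : Steps F (Tm.bangs p F'))
    (hF' : Closed F') (hM : ∀ i, Steps (M i) (Tm.bangs p (N i))) (hN : ∀ i, Closed (N i)) :
    Steps (appsBangs p F M) (Tm.bangs p (Tm.apps F' N)) := by
  induction m generalizing F F' with
  | zero => simpa [Tm.appsBangs, Tm.apps] using hF
  | succ m ih =>
    simp only [Tm.appsBangs, Tm.apps, List.ofFn_succ, List.foldl_cons]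
    refine ih (F' := .app F' (N 0)) ?_ (fun σ => by rw [subst, hF', hN]) (fun i => hM i.succ)
      fun i => hN i.succ
    exact ((appR _ hF).app (hM 0)).trans (appBangs p hF' (hN 0))

end Steps

/-! ### Open terms computing functions; basic functions and composition -/

/-- The open term `E` computes `f` on its first `k` variables, which are of type `N` and may occur
any number of times. -/
def Computes (p : ℕ) {k : ℕ} (E : Tm) (f : (Fin k → ℕ) → ℕ) : Prop :=
  (∀ δ, HasType (List.replicate k (δ, Ty.nat)) δ E (Ty.bangs p Ty.nat)) ∧
    ∀ (n : Fin k → ℕ) (σ : ℕ → Tm), (∀ i : Fin k, σ i = numeral (n i)) →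
      Steps (subst σ E) (bangs p (numeral (f n)))

namespace Computes

variable {k p : ℕ} {E : Tm} {f : (Fin k → ℕ) → ℕ}

theorem exists_closed (h : Computes p E f) :
    ∃ C : Tm, (∀ δ, HasType [] δ C (Ty.natFun k (Ty.bangs (p + 1) Ty.nat))) ∧
      ∀ n : Fin k → ℕ,
        Steps (apps C fun i => numeral (n i)) (bangs (p + 1) (numeral (f n))) := by
  -- The abstractions give the first argument the largest index; `wrap id` reverses the order again,
  -- so that `E` sees argument `i` as variable `i`.
  refine ⟨lam^[k] (wrap id k (bang E)), fun δ => .iterate_lam (fun j hj => ?_) (.wrap ?_ ?_),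
    fun n => ?_⟩
  · have : occ (j + k) E = 0 := (h.1 0).occ_eq_zero (by simp)
    simp [occ_wrap_id, hj, occ, this]
  · intro b hb; simp [hb]
  · rw [Ty.bangs_succ]; exact .bang ((h.1 (δ + 1)).weaken _)
  · obtain ⟨τ, hs, hlt, -⟩ :=
      Steps.apps_iterate_lam var (wrap id k (bang E)) fun i => numeral (n i)
    obtain ⟨τ', hs', hlt', -⟩ := Steps.wrap τ id k (bang E) n fun b => by
      simpa using hlt b.rev
    rw [subst_var] at hs
    rw [bangs_succ]
    exact hs.trans (hs'.trans (h.2 n τ' hlt').bang)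

theorem lift_succ (h : Computes p E f) : Computes (p + 1) (app (lift p) E) f :=
  ⟨fun δ => .app (.lift _ _ _) (h.1 δ), fun n σ hσ => by
    rw [subst, closed_lift p]
    exact (Steps.appR _ (h.2 n σ hσ)).trans (Steps.lift _ _)⟩

theorem exists_of_le (h : Computes p E f) {q : ℕ} (hpq : p ≤ q) : ∃ E', Computes q E' f := by
  induction q, hpq using Nat.le_induction with
  | base => exact ⟨E, h⟩
  | succ q _ ih => obtain ⟨E', h'⟩ := ih; exact ⟨_, h'.lift_succ⟩

theorem zero (k : ℕ) : Computes 0 (numeral 0) (fun _ : Fin k → ℕ => 0) :=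
  ⟨fun δ => .numeral _ _ _, fun n σ _ => by rw [closed_numeral]; exact .refl⟩

theorem proj (i : Fin k) : Computes 0 (var i) (fun x => x i) :=
  ⟨fun δ => .var (by simp [Ty.bangs]), fun n σ h => by rw [subst, h]; exact .refl⟩

theorem succ : Computes 0 (app succ (var 0)) (fun x : Fin 1 → ℕ => x 0 + 1) :=
  ⟨fun δ => .app (.succ _ _) (.var rfl), fun n σ h => by
    rw [subst, subst, closed_succ, show σ 0 = _ from h 0]; exact .succ _⟩

theorem iterate_pred (m n : ℕ) : Steps ((app pred)^[n] (numeral m)) (numeral (m - n)) :=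
  Steps.iterate_app (M := fun j => numeral (m - j)) (fun j => Steps.pred (m - j)) n

/-- The iterated predecessor is available only under a bang, so the minuend is coerced to that
depth; this costs the one bang. -/
theorem sub : Computes 1
    (letb (app coerc (var 0)) (letb (app (var 2) (bang pred)) (bang (app (var 0) (var 1)))))
    (fun x : Fin 2 → ℕ => x 0 - x 1) := by
  refine ⟨fun δ => .letb (.app (.coerc _ _) (.var rfl)) (.letb
    (.app (HasType.nat_spec (.var rfl) .nat) (.bang (.pred _ _)))
    (.bang (.app (.var rfl) (.var rfl)))), fun n σ h => ?_⟩
  have h0 : σ 0 = _ := h 0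
  have h1 : σ 1 = _ := h 1
  simp only [subst, closed_coerc _, closed_pred _, ups, h0, h1, (closed_numeral _).rename, rename]
  refine (Steps.letL _ (.coerc _)).trans ((Steps.letBang rfl).trans ?_)
  simp only [inst, subst, closed_pred _, closed_numeral _ _, ups, single,
    (closed_numeral _).rename]
  refine (Steps.letL _ (Steps.numeral_bang_closed _ closed_pred)).trans
    ((Steps.letBang rfl).trans (Steps.bang ?_))
  simp only [subst, closed_numeral _ _, single]
  exact (Steps.lam_iterate_app _ closed_pred _).trans (iterate_pred _ _)

theorem comp {m q : ℕ} {G : Tm} {g : (Fin m → ℕ) → ℕ} {E : Fin m → Tm}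
    {f : Fin m → (Fin k → ℕ) → ℕ} (hg : Computes p G g) (hf : ∀ j, Computes q (E j) (f j)) :
    ∃ E', Computes (q + (p + 1)) E' (fun x => g (fun j => f j x)) := by
  obtain ⟨C, hC, hC'⟩ := hg.exists_closed
  -- The terms `E j` may share variables because the result is still open. `C` contributes `p + 1`
  -- bangs inside the `q` bangs of its arguments.
  refine ⟨appsBangs q (bangs q C) E, fun δ => ?_, fun n σ hσ => ?_⟩
  · rw [Ty.bangs_add]
    exact .appsBangs (.bangs ((hC _).closed_weaken _)) fun j => (hf j).1 δ
  · rw [subst_appsBangs, (hC 0).closed.bangs q, bangs_add]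
    exact (Steps.appsBangs .refl (hC 0).closed (fun j => (hf j).2 n σ hσ)
      fun j => closed_numeral _).trans ((hC' _).bangs q)

end Computes

/-! ### Lists of numerals and bounded folds -/

/-- Lists of numerals, with eliminators into a fixed type `t`. -/
def Ty.listNat (t : Ty) : Ty := arr (bang (arr nat (arr t t))) (bang (arr t t))

namespace Tm

/-- The empty list of numerals. -/
def nil : Tm := lam (bang (lam (var 0)))

/-- The function that sends the list `[a₁, …, a_j]` to `[1, a₁ + 1, …, a_j + 1]`. -/
def consMapSucc : Tm :=
  lam (lam (letb (var 0)
    (letb (app (var 2) (bang (lam (lam (app (app (var 2) (app succ (var 1))) (var 0))))))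
      (bang (lam (app (app (var 2) (numeral 1)) (app (var 1) (var 0))))))))

end Tm

namespace HasType

theorem nil (Γ : Ctx) (δ : ℕ) (t : Ty) : HasType Γ δ nil t.listNat :=
  .lam (by decide) (.bang (.lam (by decide) (.var rfl)))

/-- The eliminator type `t` is preserved, so a Church numeral can iterate this term at `t.listNat`
without quantifying over `t`. -/
theorem consMapSucc (Γ : Ctx) (δ : ℕ) (t : Ty) :
    HasType Γ δ consMapSucc (.arr t.listNat t.listNat) :=
  .lam (by decide) (.lam (by decide) (.letb (.var rfl)
    (.letb
      (.app (.var rfl) (.bang (.lam (by decide) (.lam (by decide)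
        (.app (.app (.var rfl) (.app (succ _ _) (.var rfl))) (.var rfl))))))
      (.bang (.lam (by decide)
        (.app (.app (.var rfl) (numeral _ _ _)) (.app (.var rfl) (.var rfl))))))))

end HasType

theorem Tm.closed_nil : Closed nil := (HasType.nil [] 0 .one).closed

theorem Tm.closed_consMapSucc : Closed consMapSucc := (HasType.consMapSucc [] 0 .one).closed

/-- The right fold `h 1 (h 2 (⋯ (h j r)))`. -/
def foldUp : (ℕ → ℕ → ℕ) → ℕ → ℕ → ℕ
  | _, 0, r => r
  | h, j + 1, r => h 1 (foldUp (fun a => h (a + 1)) j r)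

theorem foldUp_add (f : ℕ → ℕ) (j : ℕ) :
    foldUp (fun a r => f a + r) j 0 = ∑ i ∈ Finset.Icc 1 j, f i := by
  -- After this reindexing the first summand can be split off, as in `foldUp`, with `f` shifted in
  -- the rest.
  have h : ∀ f : ℕ → ℕ, ∑ i ∈ Finset.Icc 1 j, f i = ∑ i ∈ Finset.range j, f (i + 1) := by
    intro f
    rw [Finset.range_eq_Ico, Finset.sum_Ico_add' f 0 j 1]; rfl
  rw [h]
  clear h
  induction j generalizing f with
  | zero => rfl
  | succ j ih => rw [foldUp, ih (fun a => f (a + 1)), Finset.sum_range_succ', add_comm]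

theorem foldUp_mul (f : ℕ → ℕ) (j : ℕ) :
    foldUp (fun a r => f a * r) j 1 = ∏ i ∈ Finset.Icc 1 j, f i := by
  have h : ∀ f : ℕ → ℕ, ∏ i ∈ Finset.Icc 1 j, f i = ∏ i ∈ Finset.range j, f (i + 1) := by
    intro f
    rw [Finset.range_eq_Ico, Finset.prod_Ico_add' f 0 j 1]; rfl
  rw [h]
  clear h
  induction j generalizing f with
  | zero => rfl
  | succ j ih => rw [foldUp, ih (fun a => f (a + 1)), Finset.prod_range_succ', mul_comm]

/-- The behaviour of the list `[1, …, j]`, applied to a closed boxed term. -/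
theorem Steps.list_bang (j : ℕ) {c : Tm} (hc : Closed c) :
    ∃ g, Closed g ∧ Steps (Tm.app ((Tm.app consMapSucc)^[j] nil) (Tm.bang c)) (Tm.bang g) ∧
      ∀ (q : ℕ) (h : ℕ → ℕ → ℕ),
        (∀ a r, Steps (Tm.app (Tm.app c (numeral a)) (Tm.bangs q (numeral r)))
          (Tm.bangs q (numeral (h a r)))) →
        ∀ r, Steps (Tm.app g (Tm.bangs q (numeral r))) (Tm.bangs q (numeral (foldUp h j r))) := by
  induction j generalizing c with
  | zero => exact ⟨.lam (var 0), fun _ => rfl, beta rfl, fun q h _ r => beta rfl⟩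
  | succ j ih =>
    set l := (Tm.app consMapSucc)^[j] nil with hl
    have hlc : Closed l := closed_consMapSucc.iterate_app closed_nil j
    -- Folding `c` over `map succ l` is folding `λa. λr. c (succ a) r` over `l`; hence the induction
    -- is over all `c`.
    obtain ⟨g, hg, hs, hfold⟩ := ih
      (c := .lam (.lam (.app (.app c (.app Tm.succ (var 1))) (var 0))))
      fun σ => by simp only [subst, ups, hc _, closed_succ _, rename]
    -- The new head `1` is combined last, after the fold `g` of the shifted tail.
    refine ⟨.lam (.app (.app c (numeral 1)) (.app g (var 0))), fun σ => ?_, ?_, fun q h hh r => ?_⟩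
    · simp only [subst, ups, hc _, hg _, closed_numeral _ _]
    · rw [Function.iterate_succ_apply', ← hl]
      refine (appL _ (beta rfl)).trans ((beta rfl).trans ?_)
      simp only [inst, subst, ups, single, rename, hlc.rename, hlc _, closed_succ _, closed_numeral _ _]
      refine (letBang rfl).trans ?_
      simp only [inst, subst, ups, single, rename, hc.rename, hlc _, closed_succ _, closed_numeral _ _]
      refine (letL _ hs).trans (letBang ?_)
      simp only [inst, subst, ups, single, hc _, hg.rename, closed_numeral _ _]
    · refine (beta rfl).trans ?_
      simp only [inst, subst, single, hc _, hg _, closed_numeral _ _]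
      refine (appR _ (hfold q (fun a => h (a + 1)) (fun a r => ?_) r)).trans (hh _ _)
      refine (appL _ (beta rfl)).trans ((beta rfl).trans ?_)
      simp only [inst, subst, ups, single, hc _, closed_succ _, (closed_numeral _).rename,
        closed_numeral _ _]
      exact (appL _ (appR _ (succ a))).trans (hh _ _)

namespace Computes

theorem fold {k p : ℕ} {E : Tm} {f : (Fin (k + 1) → ℕ) → ℕ} (hf : Computes p E f) {O : Tm}
    {op : ℕ → ℕ → ℕ} (hO : ∀ δ, HasType [] δ O (.arr .nat (.arr .nat .nat)))
    (hop : ∀ a b, Steps (app (app O (numeral a)) (numeral b)) (numeral (op a b))) (e : ℕ) :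
    ∃ q E', Computes q E' (fun x : Fin (k + 1) → ℕ =>
      foldUp (fun a r => op (f (Fin.cons a (Fin.tail x))) r) (x 0) e) := by
  obtain ⟨C, hC, hCs⟩ := hf.exists_closed
  generalize p + 1 = q at hC hCs
  let t := Ty.bangs q Ty.nat
  -- In `body`, variable `0` is the accumulator, `1` the list element, which replaces the bound `x
  -- 0`, and `2` the unused copy of `x 0`; the parameters start at `3`.
  let args : Fin (k + 1) → Tm := Fin.cons (var 1) (fun i => var (i + 3))
  let body : Tm := app (app (appBangs q) (app (app (appBangs q) (bangs q O)) (apps C args))) (var 0)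
  have hOq : ∀ δ, HasType [] δ (bangs q O) (Ty.bangs q (.arr .nat (.arr .nat .nat))) :=
    fun δ => .bangs (hO _)
  have hocc : ∀ x < 2, occ x body ≤ 1 := by
    intro x hx
    have h1 : occ x (appBangs q) = 0 :=
      (HasType.appBangs [] 0 q .one .one).occ_eq_zero (by simp)
    have h2 : occ x (bangs q O) = 0 := (hOq 0).occ_eq_zero (by simp)
    have h3 : occ x C = 0 := (hC 0).occ_eq_zero (by simp)
    interval_cases x <;> simp [body, args, occ, occ_apps, Fin.sum_univ_succ, h1, h2, h3]
  have hc : ∀ δ, HasType (List.replicate (k + 1) (δ, Ty.nat)) δ (lam (lam body))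
      (.arr .nat (.arr t t)) := by
    intro δ
    refine .lam (hocc 1 (by simp)) (.lam (hocc 0 (by simp)) (.app (.app (.appBangs _ _ _ _ _)
      (.app (.app (.appBangs _ _ _ _ _) ((hOq δ).closed_weaken _))
        (.apps ((hC δ).closed_weaken _) fun i => ?_))) (.var rfl)))
    refine Fin.cases (.var rfl) (fun i => .var ?_) i
    simp
  -- Opening the iterated list builder and then the fold costs one bang each, hence `q + 2`. The
  -- parameters must sink two levels to enter the boxed step function, hence two wraps; the second
  -- skips variable `0`, the list builder. Both index functions keep the order of the variables. The
  -- first `var (k + 1)` is the original bound `x 0`, the second the list builder.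
  refine ⟨q + 2, wrap (fun b => k - b) (k + 1) (letb (app (var (k + 1)) (bang consMapSucc))
    (bang (wrap (fun b => k + 1 - b) (k + 1)
      (letb (app (app (var (k + 1)) nil) (bang (lam (lam body))))
        (bang (app (var 0) (bangs q (numeral e)))))))), fun δ => ?_, fun n σ hσ => ?_⟩
  · rw [Ty.bangs_succ, Ty.bangs_succ]
    refine .wrap (fun b hb => by simp) (.letb (.app (HasType.nat_spec (.var ?_) t.listNat)
      (.bang (.consMapSucc _ _ t))) (.bang (.wrap (fun b hb => ?_) (.letb (.app (.app (.var ?_)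
        (.nil _ _ t)) (.bang ((hc (δ + 1 + 1)).weaken _)))
          (.bang (.app (.var rfl) (.bangs (.numeral _ _ _))))))))
    · rw [List.getElem?_append_right (by simp)]; simp
    · obtain ⟨d, rfl⟩ : ∃ d, k = b + d := ⟨k - b, by omega⟩
      rw [show b + d + 1 - b = d + 1 by omega, List.getElem?_cons_succ,
        List.getElem?_append_left (by simp)]
      simp
    · rw [List.getElem?_append_right (by simp)]; simp; rfl
  · obtain ⟨τ, hs, hlt, hge⟩ := Steps.wrap σ (fun b => k - b) (k + 1) (letb _ _) n fun b => by
      rw [← hσ b.rev]; congr 1; simp [Fin.val_rev]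
    refine hs.trans ?_
    have h0 : τ (k + 1) = numeral (n 0) := (hge 0).trans (hσ 0)
    simp only [subst, h0, closed_consMapSucc _]
    generalize hW : wrap _ _ _ = W
    refine (Steps.letL _ (Steps.numeral_bang_closed _ closed_consMapSucc)).trans
      ((Steps.letBang (inst_subst_ups τ (bang W) _)).trans ?_)
    subst hW
    rw [bangs_succ, bangs_succ]
    refine Steps.bang ?_
    obtain ⟨τ', hs', hlt', hge'⟩ := Steps.wrap
      (scons (lam ((app consMapSucc)^[n 0] (var 0))) τ) (fun b => k + 1 - b) (k + 1) (letb _ _) n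
      fun b => by
        rw [← hlt b.rev, show k + 1 - b.val = b.rev.val + 1 by rw [Fin.val_rev]; omega]; rfl
    refine hs'.trans ?_
    have h0' : τ' (k + 1) = lam ((app consMapSucc)^[n 0] (var 0)) := hge' 0
    -- The step function mentions the parameters and becomes closed only once they are numerals.
    have hcl : Closed (subst τ' (lam (lam body))) := (hc 0).closed_subst fun i hi => by
      have := hlt' ⟨i, by simpa using hi⟩
      rw [show τ' i = _ from this]; exact closed_numeral _
    obtain ⟨g, hg, hgs, hfold⟩ := Steps.list_bang (n 0) hcl
    change Steps (letb (app (app (τ' (k + 1)) nil) (bang (subst τ' (lam (lam body)))))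
      (bang (app (var 0) (subst (ups τ') (bangs q (numeral e)))))) _
    rw [h0', (closed_numeral e).bangs q]
    refine (Steps.letL _ ((Steps.appL _ (Steps.lam_iterate_app _ closed_consMapSucc _)).trans
      hgs)).trans ((Steps.letBang rfl).trans (Steps.bang ?_))
    simp only [subst, single, (closed_numeral e).bangs q _]
    refine hfold q (fun a r => op (f (Fin.cons a (Fin.tail n))) r) (fun a r => ?_) e
    rw [subst]
    refine (Steps.appL _ (Steps.beta (inst_subst_ups _ (lam _) _))).trans
      ((Steps.beta (inst_subst_ups _ _ _)).trans ?_)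
    have hargs : (fun i => subst (scons (bangs q (numeral r)) (scons (numeral a) τ')) (args i)) =
        fun i => numeral ((Fin.cons a (Fin.tail n) : Fin (k + 1) → ℕ) i) := by
      funext i
      refine Fin.cases rfl (fun i => ?_) i
      exact hlt' i.succ
    simp only [body, subst, subst_apps, closed_appBangs q _, (hOq 0).closed _, (hC 0).closed _,
      hargs, scons]
    refine (Steps.appL _ (Steps.appR _ ((Steps.appR _ (hCs _)).trans
      (Steps.appBangs q (hO 0).closed (closed_numeral _))))).trans ((Steps.appBangs q (fun σ => ?_)
        (closed_numeral _)).trans ((hop _ _).bangs q))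
    rw [subst, (hO 0).closed, closed_numeral]

end Computes

/-! ### Induction over elementary functions and conclusion -/

theorem Elementary.exists_computes {k : ℕ} {f : (Fin k → ℕ) → ℕ} (hf : Elementary f) :
    ∃ p E, Computes p E f := by
  induction hf with
  | zero k => exact ⟨_, _, .zero k⟩
  | succ => exact ⟨_, _, .succ⟩
  | proj i => exact ⟨_, _, .proj i⟩
  | sub => exact ⟨_, _, .sub⟩
  | comp _ _ ihg ihf =>
    obtain ⟨p, G, hG⟩ := ihg
    choose q E hE using ihf
    -- All inner functions are lifted to the supremum of their numbers of bangs.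
    choose E' hE' using fun j => (hE j).exists_of_le (Finset.le_sup (Finset.mem_univ j))
    exact ⟨_, hG.comp hE'⟩
  | bsum _ ih =>
    obtain ⟨p, E, hE⟩ := ih
    simpa only [foldUp_add] using hE.fold (fun δ => .add [] δ) Steps.add 0
  | bprod _ ih =>
    obtain ⟨p, E, hE⟩ := ih
    simpa only [foldUp_mul] using hE.fold (fun δ => .mul [] δ) Steps.mul 1

end EA

theorem mainTheorem4 {k : ℕ} (f : (Fin k → ℕ) → ℕ) (hf : EA.Elementary f) :
    ∃ (p : ℕ) (F : EA.Tm), ∀ δ : ℕ, EA.RepresentsFun δ p F f := by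
  obtain ⟨p, E, hE⟩ := hf.exists_computes
  obtain ⟨F, hF, hFs⟩ := hE.exists_closed
  exact ⟨p + 1, F, fun δ => ⟨hF δ, fun M n hM =>
    ⟨.apps (hF δ) fun i => (hM i).1, (EA.Steps.apps .refl fun i => (hM i).2).trans (hFs n)⟩⟩⟩
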